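/- Let $F=\mathbb{F}_q$ be a finite field and let $a\in F$ with $a\neq 0,1$. For $A\in F^{n\times n}$ put $C(A,a)=\{B\in F^{n\times n} : AB=aBA\}$, regarded as a linear code of length $n^2$ over $F$; the minimum distance of a nonzero code is the least Hamming weight (number of nonzero entries) of a nonzero codeword. Then there is an integer $n_0$ such that for every $n\ge n_0$ there exists a matrix $A\in F^{n\times n}$ for which the code $C(A,a)$ is nonzero and has minimum distance at least $n/\log n$, where $\log$ is the natural logarithm. -/

import Mathlib

/-- The centralizer code of `A` twisted by `a`: all matrices `B` with `A B = a B A`. -/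
def twistedCentralizerCode {F : Type*} [Field F] {n : ℕ}
    (A : Matrix (Fin n) (Fin n) F) (a : F) : Submodule F (Matrix (Fin n) (Fin n) F) where
  carrier := {B | A * B = a • (B * A)}
  zero_mem' := by simp
  add_mem' := by
    intro B B' hB hB'
    simp only [Set.mem_ofPred_eq] at hB hB' ⊢
    rw [mul_add, add_mul, smul_add, hB, hB']
  smul_mem' := by
    intro c B hB
    simp only [Set.mem_ofPred_eq] at hB ⊢
    rw [Matrix.mul_smul, Matrix.smul_mul, hB, smul_comm]

/-- The Hamming weight of a matrix, i.e. the number of its nonzero entries: the matrix is read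
column by column as a vector with `n ^ 2` coordinates. -/
def matrixWeight {F : Type*} [Field F] [DecidableEq F] {n : ℕ}
    (B : Matrix (Fin n) (Fin n) F) : ℕ :=
  hammingNorm B.vec

/-- The minimum distance of a nonzero linear code of matrices: the least Hamming weight of a
nonzero codeword. (For the zero code, which has no minimum distance, the value is the junk
value `0`.) -/
noncomputable def minDistance {F : Type*} [Field F] [DecidableEq F] {n : ℕ}
    (C : Submodule F (Matrix (Fin n) (Fin n) F)) : ℕ :=
  sInf {w : ℕ | ∃ B ∈ C, B ≠ 0 ∧ matrixWeight B = w}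

open Matrix

/-! Take `A = 1 - u vᵀ` with `vᵀu = 1`. If `AB = aBA`, then `B` preserves both one-dimensional
kernels of `A`, so `Bu = cu` and `vᵀB = cvᵀ` with the same `c`. Then `AB` and `BA` both equal `B - c
u vᵀ`, and `a ≠ 1` forces `B = c u vᵀ`. The code is thus a line, with minimum distance wt(`u`)
wt(`v`). Taking `u` all ones and `v` almost full gives at least `n(n-1)`, far above `n / log n`. -/

/-- If `v ⬝ᵥ u = 1`, then `1 - u vᵀ` is idempotent with kernel spanned by `u` and left kernel
spanned by `v`, and its twisted centralizer code is the line spanned by `u vᵀ`. -/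
theorem twistedCentralizerCode_one_sub_vecMulVec {F : Type*} [Field F] {n : ℕ} {a : F}
    (ha0 : a ≠ 0) (ha1 : a ≠ 1) {u v : Fin n → F} (h : v ⬝ᵥ u = 1) :
    twistedCentralizerCode (1 - vecMulVec u v) a = Submodule.span F {vecMulVec u v} := by
  set A : Matrix (Fin n) (Fin n) F := 1 - vecMulVec u v with hA
  have hAu : A *ᵥ u = 0 := by
    rw [hA, sub_mulVec, one_mulVec, vecMulVec_mulVec, h]; simp
  have hvA : v ᵥ* A = 0 := by
    rw [hA, vecMul_sub, vecMul_one, vecMul_vecMulVec, h, one_smul, sub_self]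
  ext B
  rw [Submodule.mem_span_singleton]
  constructor
  · intro (hB : A * B = a • (B * A))
    set c := v ⬝ᵥ (B *ᵥ u) with hc
    have hBu : B *ᵥ u = c • u := by
      have h0 : A *ᵥ (B *ᵥ u) = 0 := by
        rw [mulVec_mulVec, hB, smul_mulVec, ← mulVec_mulVec, hAu, mulVec_zero, smul_zero]
      rw [hA, sub_mulVec, one_mulVec, vecMulVec_mulVec, sub_eq_zero] at h0
      simpa [hc] using h0
    have hvB : v ᵥ* B = c • v := by
      have h0 : (v ᵥ* B) ᵥ* A = 0 := by
        -- On the left side the twist gives only `a vᵀBA = vᵀAB = 0`, so `a` has to be cancelled.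
        have h1 : a • ((v ᵥ* B) ᵥ* A) = 0 := by
          rw [vecMul_vecMul, ← vecMul_smul, ← hB, ← vecMul_vecMul, hvA, zero_vecMul]
        exact (smul_eq_zero.1 h1).resolve_left ha0
      rw [hA, vecMul_sub, vecMul_one, vecMul_vecMulVec, sub_eq_zero, ← dotProduct_mulVec] at h0
      exact h0
    refine ⟨c, ?_⟩
    rw [hA, sub_mul, mul_sub, one_mul, mul_one, vecMulVec_mul, mul_vecMulVec, hBu, hvB,
      vecMulVec_smul, smul_vecMulVec, smul_sub] at hB
    have h1 : (1 - a) • (B - c • vecMulVec u v) = 0 := by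
      rw [sub_smul, one_smul, smul_sub, hB, sub_self]
    exact (sub_eq_zero.1 ((smul_eq_zero.1 h1).resolve_left (sub_ne_zero.2 ha1.symm))).symm
  · rintro ⟨c, rfl⟩
    change A * (c • vecMulVec u v) = a • (c • vecMulVec u v * A)
    rw [mul_smul_comm, smul_mul_assoc, mul_vecMulVec, vecMulVec_mul, hAu, hvA]
    simp

/-- The weight of a rank-one matrix is the product of the weights of its factors. -/
theorem matrixWeight_vecMulVec {F : Type*} [Field F] [DecidableEq F] {n : ℕ} (u v : Fin n → F) :
    matrixWeight (vecMulVec u v) = hammingNorm v * hammingNorm u := by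
  unfold matrixWeight hammingNorm
  rw [← Finset.card_product]
  congr 1
  ext ⟨j, i⟩
  simp [vec, vecMulVec_apply, and_comm]

theorem matrixWeight_smul {F : Type*} [Field F] [DecidableEq F] {n : ℕ} {c : F} (hc : c ≠ 0)
    (B : Matrix (Fin n) (Fin n) F) : matrixWeight (c • B) = matrixWeight B := by
  rw [matrixWeight, matrixWeight, vec_smul]
  exact hammingNorm_smul (fun _ => (IsUnit.mk0 c hc).isSMulRegular F) B.vec

theorem minDistance_span_singleton {F : Type*} [Field F] [DecidableEq F] {n : ℕ}
    {B : Matrix (Fin n) (Fin n) F} (hB : B ≠ 0) :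
    minDistance (Submodule.span F {B}) = matrixWeight B := by
  have h : {w : ℕ | ∃ B' ∈ Submodule.span F {B}, B' ≠ 0 ∧ matrixWeight B' = w}
      = {matrixWeight B} := by
    ext w
    constructor
    · rintro ⟨B', hB', hne, rfl⟩
      obtain ⟨c, rfl⟩ := Submodule.mem_span_singleton.1 hB'
      exact matrixWeight_smul (fun h => hne (by rw [h, zero_smul])) B
    · rintro rfl
      exact ⟨B, Submodule.mem_span_singleton_self B, hB, rfl⟩
  rw [minDistance, h, csInf_singleton]

/-- There is a vector with coordinate sum `1` and at most one zero coordinate. -/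
theorem exists_sum_eq_one_hammingNorm {F : Type*} [Field F] [DecidableEq F] {n : ℕ}
    (hn : 0 < n) : ∃ v : Fin n → F, v ⬝ᵥ 1 = 1 ∧ n - 1 ≤ hammingNorm v := by
  obtain ⟨m, rfl⟩ : ∃ m, n = m + 1 := ⟨n - 1, by omega⟩
  -- The head entry corrects the sum of the `m` ones; it vanishes when `m = 1` in `F`, so only the
  -- tail is counted.
  refine ⟨Fin.cons (1 - m) 1, ?_, ?_⟩
  · simp [dotProduct, Fin.sum_univ_succ]
  · calc m + 1 - 1 = (Finset.univ.map (Fin.succEmb m)).card := by simp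
      _ ≤ _ := by
        refine Finset.card_le_card fun i hi => ?_
        obtain ⟨j, -, rfl⟩ := Finset.mem_map.1 hi
        simp

/-- For every `n ≥ 2` some twisted centralizer code is nonzero and has minimum distance at least
`n (n - 1)`. -/
theorem exists_minDistance_twistedCentralizerCode {F : Type*} [Field F] [DecidableEq F]
    {a : F} (ha0 : a ≠ 0) (ha1 : a ≠ 1) {n : ℕ} (hn : 2 ≤ n) :
    ∃ A : Matrix (Fin n) (Fin n) F, twistedCentralizerCode A a ≠ ⊥ ∧
      (n - 1) * n ≤ minDistance (twistedCentralizerCode A a) := by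
  obtain ⟨v, hv, hw⟩ := exists_sum_eq_one_hammingNorm (F := F) (n := n) (by omega)
  have hne : vecMulVec (1 : Fin n → F) v ≠ 0 := by
    intro h0
    have h1 : (v ᵥ* vecMulVec (1 : Fin n → F) v) ⬝ᵥ 1 = 1 := by
      rw [vecMul_vecMulVec, hv, one_smul, hv]
    rw [h0, vecMul_zero, zero_dotProduct] at h1
    exact zero_ne_one h1
  refine ⟨1 - vecMulVec 1 v, ?_, ?_⟩
  · rwa [twistedCentralizerCode_one_sub_vecMulVec ha0 ha1 hv, Ne,
      Submodule.span_singleton_eq_bot]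
  · rw [twistedCentralizerCode_one_sub_vecMulVec ha0 ha1 hv, minDistance_span_singleton hne,
      matrixWeight_vecMulVec]
    exact Nat.mul_le_mul hw (by simp [hammingNorm])

theorem theorem3p6 {F : Type*} [Field F] [Fintype F] [DecidableEq F]
    (a : F) (ha0 : a ≠ 0) (ha1 : a ≠ 1) :
    ∀ᶠ n : ℕ in Filter.atTop, ∃ A : Matrix (Fin n) (Fin n) F,
      twistedCentralizerCode A a ≠ ⊥ ∧
        (n : ℝ) / Real.log n ≤ (minDistance (twistedCentralizerCode A a) : ℝ) := by
  -- `3 > e` ensures `log n ≥ 1`.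
  filter_upwards [Filter.eventually_ge_atTop 3] with n hn
  obtain ⟨A, hA, hd⟩ := exists_minDistance_twistedCentralizerCode ha0 ha1 (n := n) (by omega)
  refine ⟨A, hA, ?_⟩
  have hlog : 1 ≤ Real.log n := by
    rw [Real.le_log_iff_exp_le (by positivity)]
    have h3 : (3 : ℝ) ≤ n := by exact_mod_cast hn
    linarith [Real.exp_one_lt_d9]
  calc (n : ℝ) / Real.log n ≤ n := div_le_self (by positivity) hlog
    _ ≤ _ := by exact_mod_cast (Nat.le_mul_of_pos_left n (by omega)).trans hd
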